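/- Let $X$ be a $\sigma$-compact metric space with its Borel $\sigma$-algebra, and let $\sigma$ be a $\sigma$-finite diffuse measure on $X$ (i.e. $\sigma(\{x\})=0$ for all $x\in X$) that is finite on compact sets. Let $\Omega^X$ be the space of at most countable, locally finite subsets $\omega$ of $X$. Each $\omega$ is identified with the point measure $\sum_{x\in\omega}\epsilon_x$, where $\epsilon_x$ is the Dirac measure at $x$, and $\Omega^X$ carries the $\sigma$-algebra generated by the maps $\omega\mapsto\omega(A)$, $A$ a Borel subset of $X$. Let $\pi_\sigma$ be the Poisson probability measure on $\Omega^X$ with intensity $\sigma$, i.e. for all pairwise disjoint compact sets $A_1,\dots,A_m\subset X$ the random variables $\omega(A_1),\dots,\omega(A_m)$ are independent and Poisson distributed with parameters $\sigma(A_1),\dots,\sigma(A_m)$. Write $E$ for the expectation under $\pi_\sigma$. Let $F:\Omega^X\to\mathbb R$ be a bounded random variable, and let $u:\Omega^X\times X\to\mathbb R$, $(\omega,x)\mapsto u_x(\omega)$, be a bounded (jointly measurable) random process with compact support in $X$, i.e. there is a compact set $K\subset X$ with $u_x(\omega)=0$ for all $\omega\in\Omega^X$ and $x\in X\setminus K$.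 Then for all $n\ge 0$ $$ E\left[F\left(\int_X u_x(\omega)\,\omega(dx)\right)^n\right] =\sum_{\{P_1,\dots,P_k\}}E\left[\int_{X^k}\varepsilon^+_{s_1,\dots,s_k}\left(F\,u_{s_1}^{|P_1|}\cdots u_{s_k}^{|P_k|}\right)\sigma(ds_1)\cdots\sigma(ds_k)\right], $$ where all the integrals and expectations are absolutely convergent. The sum runs over all partitions $\{P_1,\dots,P_k\}$ of $\{1,\dots,n\}$ into non-empty blocks (for $n=0$ there is only the empty partition, with $k=0$, whose term is $E[F]$), $|P_i|$ is the cardinality of $P_i$, and $$ \varepsilon^+_{s_1,\dots,s_k}\left(F\,u_{s_1}^{|P_1|}\cdots u_{s_k}^{|P_k|}\right)(\omega) =F(\omega\cup\{s_1,\dots,s_k\})\prod_{i=1}^k u_{s_i}(\omega\cup\{s_1,\dots,s_k\})^{|P_i|}. $$ -/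

import Mathlib

open MeasureTheory ProbabilityTheory

/-- The configuration space over `X`: the at most countable, locally finite subsets of `X`, that is,
those which have finitely many points in every compact set (in a metric space this is the same as
every point having a neighbourhood with finitely many points of the set). -/
structure Configuration (X : Type*) [TopologicalSpace X] where
  /-- The set of points of the configuration. -/
  points : Set X
  countable_points : points.Countable
  finite_inter : ∀ K : Set X, IsCompact K → (points ∩ K).Finite

namespace Configuration

/-- The point measure (sum of the Dirac measures at its points) of a configuration. -/
noncomputable def toMeasure {X : Type*} [TopologicalSpace X] [MeasurableSpace X]
    (ω : Configuration X) : Measure X :=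
  Measure.sum fun x : ω.points => Measure.dirac (x : X)

/-- The sigma-algebra on the configuration space generated by the counts `ω ↦ ω(A)`, where `A` runs
over the measurable subsets of `X` (`Measure X` carries the sigma-algebra generated by the
evaluations at measurable sets). -/
noncomputable instance instMeasurableSpace {X : Type*} [TopologicalSpace X] [MeasurableSpace X] :
    MeasurableSpace (Configuration X) :=
  MeasurableSpace.comap toMeasure inferInstance

/-- The configuration `ω ∪ {s₁, …, sₖ}`. -/
def addPoints {X : Type*} [TopologicalSpace X] {ι : Type*} [Finite ι]
    (ω : Configuration X) (s : ι → X) : Configuration X where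
  points := ω.points ∪ Set.range s
  countable_points := ω.countable_points.union (Set.finite_range s).countable
  finite_inter K hK := by
    rw [Set.union_inter_distrib_right]
    exact (ω.finite_inter K hK).union ((Set.finite_range s).inter_of_left K)

end Configuration

/-- `π` is the Poisson probability measure with intensity `σ` on the configuration space: for all
pairwise disjoint compact sets `A₁, …, Aₘ` the counts `ω(A₁), …, ω(Aₘ)` are independent and Poisson
distributed with parameters `σ(A₁), …, σ(Aₘ)`. It is meant for `σ` finite on compact sets. -/
structure IsPoissonLaw {X : Type*} [TopologicalSpace X] [MeasurableSpace X]
    (σ : Measure X) (π : Measure (Configuration X)) : Prop where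
  isProbabilityMeasure : IsProbabilityMeasure π
  poisson_count : ∀ A : Set X, IsCompact A →
    π.map (fun ω => ω.toMeasure A) =
      (poissonMeasure (σ A).toNNReal).map (fun k : ℕ => (k : ENNReal))
  indep_count : ∀ (m : ℕ) (A : Fin m → Set X), (∀ i, IsCompact (A i)) →
    (∀ i j, i ≠ j → Disjoint (A i) (A j)) →
    iIndepFun (fun (i : Fin m) (ω : Configuration X) => ω.toMeasure (A i)) π

/-- The quantity `ε⁺_{s₁,…,sₖ} (F u_{s₁}^{|P₁|} ⋯ u_{sₖ}^{|Pₖ|})` at `ω`, for a partition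
`P = {P₁, …, Pₖ}` of an `n`-element set; the points `s` are indexed by the blocks of `P`. -/
noncomputable def addedIntegrand {X : Type*} [TopologicalSpace X]
    (F : Configuration X → ℝ) (u : Configuration X → X → ℝ) {n : ℕ}
    (P : Finpartition (Finset.univ : Finset (Fin n)))
    (ω : Configuration X) (s : P.parts → X) : ℝ :=
  F (ω.addPoints s) * ∏ p : P.parts, u (ω.addPoints s) (s p) ^ (p : Finset (Fin n)).card

/-! For fixed `ω` the integral of `u` is a finite sum over the points of `ω` in `K`, so its `n`-th
power is a sum over `n`-tuples of points. Sorting the tuples by which coordinates coincide turns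
each into a partition of the indices together with distinct points indexed by the blocks
(`tsum_pow_eq_sum_finpartition`). Each partition then contributes a sum over distinct points, whose
expectation is given by the multivariate Mecke formula: a sum over distinct points of `ω` becomes an
integral against a power of `σ`, with the points added to `ω` (`integral_tsum_embedding`). It must
allow integrands depending on `ω`, as `F` and `u` do.

The one-point Mecke formula `compProd_kernel` equates two measures on pairs `(ω, x)`. On products of
cylinder events and relatively compact sets it reduces to the Stein identity `E[N h(N)] = λ E[h(N +
1)]` for a Poisson variable, combined with independence; since `σ` is diffuse, an added point is
almost surely new and raises its count by exactly one. The Poisson law is prescribed on compact sets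
only, so inner regularity is needed to reach disjoint Borel pieces. Induction on the number of
points, with Tonelli, gives the multivariate formula (`factorialSum_fin`). -/

/-- Cutting the source by the integer part `m` of the mass of `D n` leaves pieces of mass at most `m
+ 1`. The kernel of point measures is finite on compact sets without a uniform bound in `ω`;
s-finiteness is what makes its parametrized integrals measurable. -/
theorem ProbabilityTheory.Kernel.isSFiniteKernel_of_iUnion {α β : Type*} [MeasurableSpace α]
    [MeasurableSpace β] (κ : Kernel α β) (D : ℕ → Set β) (hD : ∀ n, MeasurableSet (D n))
    (hdisj : Pairwise (Function.onFun Disjoint D)) (hcov : ⋃ n, D n = Set.univ)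
    (hfin : ∀ a n, κ a (D n) < ⊤) : IsSFiniteKernel κ := by
  classical
  let s : ℕ → ℕ → Set α := fun n m => {a | ⌊(κ a (D n)).toReal⌋₊ = m}
  have hs : ∀ n m, MeasurableSet (s n m) := fun n m =>
    (Nat.measurable_floor.comp (κ.measurable_coe (hD n)).ennreal_toReal) (measurableSet_singleton m)
  let η : ℕ → ℕ → Kernel α β := fun n m => Kernel.piecewise (hs n m) (κ.restrict (hD n)) 0
  have hη : ∀ n m, IsFiniteKernel (η n m) := by
    intro n m
    refine ⟨⟨ENNReal.ofReal (m + 1), ENNReal.ofReal_lt_top, fun a => ?_⟩⟩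
    simp only [η, Kernel.piecewise_apply]
    split_ifs with h
    · rw [Kernel.restrict_apply, Measure.restrict_apply_univ,
        ← ENNReal.ofReal_toReal (hfin a n).ne]
      refine ENNReal.ofReal_le_ofReal ?_
      have h' : ⌊(κ a (D n)).toReal⌋₊ = m := h
      exact h' ▸ (Nat.lt_floor_add_one _).le
    · simp
  have hκ : κ = Kernel.sum fun n => Kernel.sum fun m => η n m := by
    ext a t ht
    rw [Kernel.sum_apply' _ _ ht]
    have h1 : ∀ n, (Kernel.sum fun m => η n m) a t = κ a (t ∩ D n) := by
      intro n
      rw [Kernel.sum_apply' _ _ ht, tsum_eq_single ⌊(κ a (D n)).toReal⌋₊]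
      · simp only [η, Kernel.piecewise_apply]
        rw [if_pos (show a ∈ s n _ from rfl), Kernel.restrict_apply, Measure.restrict_apply ht]
      · intro m hm
        simp only [η, Kernel.piecewise_apply]
        rw [if_neg (show a ∉ s n m from fun h => hm (Eq.symm h))]
        simp
    simp_rw [h1]
    rw [← measure_iUnion (fun i j hij => (hdisj hij).mono Set.inter_subset_right
      Set.inter_subset_right) (fun n => ht.inter (hD n)), ← Set.inter_iUnion, hcov, Set.inter_univ]
  rw [hκ]
  exact inferInstance

/-! ### Point measures, adding points, and measurability -/

namespace Configuration

@[ext]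
theorem ext {X : Type*} [TopologicalSpace X] {ω η : Configuration X} (h : ω.points = η.points) :
    ω = η := by
  cases ω; cases η; simp_all

section AddPoints

variable {X : Type*} [TopologicalSpace X]

theorem addPoints_comp_equiv {ι κ : Type*} [Finite ι] [Finite κ] (e : κ ≃ ι)
    (ω : Configuration X) (s : ι → X) : ω.addPoints (s ∘ e) = ω.addPoints s := by
  ext1
  simp [addPoints, Set.range_comp]

/-- The configuration `ω ∪ {x}`. -/
def addPoint (ω : Configuration X) (x : X) : Configuration X := ω.addPoints fun _ : Unit => x

@[simp]
theorem points_addPoint (ω : Configuration X) (x : X) :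
    (ω.addPoint x).points = insert x ω.points := by
  simp [addPoint, addPoints]

theorem addPoint_of_mem {ω : Configuration X} {x : X} (h : x ∈ ω.points) : ω.addPoint x = ω := by
  ext1; simp [h]

theorem addPoints_cons {n : ℕ} (ω : Configuration X) (s : Fin n → X) (x : X) :
    ω.addPoints (Fin.cons x s : Fin (n + 1) → X) = (ω.addPoint x).addPoints s := by
  ext1
  show ω.points ∪ _ = (ω.addPoint x).points ∪ _
  rw [Fin.range_cons, points_addPoint]
  simp [Set.insert_union]

theorem addPoints_of_isEmpty {ι : Type*} [Finite ι] [IsEmpty ι] (ω : Configuration X) (s : ι → X) :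
    ω.addPoints s = ω := by
  ext1
  simp [addPoints, Set.range_eq_empty]

end AddPoints

section Measurable

variable {X : Type*} [TopologicalSpace X] [MeasurableSpace X]

instance (ω : Configuration X) : Countable ω.points := ω.countable_points

theorem measurable_toMeasure : Measurable (toMeasure : Configuration X → Measure X) :=
  comap_measurable _

theorem measurable_toMeasure_apply {A : Set X} (hA : MeasurableSet A) :
    Measurable fun ω : Configuration X => ω.toMeasure A :=
  (Measure.measurable_coe hA).comp measurable_toMeasure

theorem lintegral_toMeasure (ω : Configuration X) {f : X → ENNReal} (hf : Measurable f) :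
    ∫⁻ x, f x ∂ω.toMeasure = ∑' x : ω.points, f x := by
  simp_rw [toMeasure, lintegral_sum_measure, lintegral_dirac' _ hf]

theorem toMeasure_apply (ω : Configuration X) {A : Set X} (hA : MeasurableSet A) :
    ω.toMeasure A = ∑' x : ω.points, A.indicator 1 (x : X) := by
  rw [← lintegral_indicator_one hA, lintegral_toMeasure _ (measurable_one.indicator hA)]

theorem toMeasure_congr (ω : Configuration X) {A B : Set X} (hA : MeasurableSet A)
    (hB : MeasurableSet B) (h : ω.points ∩ A = ω.points ∩ B) : ω.toMeasure A = ω.toMeasure B := by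
  rw [toMeasure_apply ω hA, toMeasure_apply ω hB]
  refine tsum_congr fun x => ?_
  have : (x : X) ∈ A ↔ (x : X) ∈ B := by
    have := Set.ext_iff.1 h x
    simpa [x.2] using this
  by_cases hx : (x : X) ∈ A
  · rw [Set.indicator_of_mem hx, Set.indicator_of_mem (this.1 hx)]
  · rw [Set.indicator_of_notMem hx, Set.indicator_of_notMem (fun h => hx (this.2 h))]

theorem toMeasure_lt_top (ω : Configuration X) {A : Set X} (hA : MeasurableSet A)
    (h : (ω.points ∩ A).Finite) : ω.toMeasure A < ⊤ := by
  rw [toMeasure_apply ω hA]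
  have hfin : {x : ω.points | (x : X) ∈ A}.Finite := by
    refine Set.Finite.of_finite_image (h.subset ?_) (Subtype.val_injective.injOn)
    rintro _ ⟨x, hx, rfl⟩
    exact ⟨x.2, hx⟩
  rw [tsum_eq_sum (s := hfin.toFinset)]
  · refine ENNReal.sum_lt_top.2 fun x _ => ?_
    by_cases hx : (x : X) ∈ A <;> simp [hx]
  · intro x hx
    have : (x : X) ∉ A := by simpa using hx
    simp [this]

theorem toMeasure_compact_lt_top [T2Space X] [OpensMeasurableSpace X] (ω : Configuration X)
    {A K : Set X} (hA : MeasurableSet A)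
    (hK : IsCompact K) (h : A ⊆ K) : ω.toMeasure A < ⊤ :=
  ω.toMeasure_lt_top hA ((ω.finite_inter K hK).subset (Set.inter_subset_inter_right _ h))

/-- The identity of the configuration space, seen as a kernel of point measures. -/
noncomputable def kernel (X : Type*) [TopologicalSpace X] [MeasurableSpace X] :
    Kernel (Configuration X) X where
  toFun := toMeasure
  measurable' := measurable_toMeasure

@[simp]
theorem kernel_apply (ω : Configuration X) : kernel X ω = ω.toMeasure := rfl

instance [T2Space X] [SigmaCompactSpace X] [OpensMeasurableSpace X] :
    IsSFiniteKernel (kernel X) := by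
  have hm : ∀ n, MeasurableSet (disjointed (compactCovering X) n) := fun n =>
    MeasurableSet.disjointed (fun n => (isCompact_compactCovering X n).measurableSet) n
  refine Kernel.isSFiniteKernel_of_iUnion _ (disjointed (compactCovering X)) hm
    (disjoint_disjointed _) ?_ fun ω n => ?_
  · rw [iUnion_disjointed, iUnion_compactCovering]
  · exact ω.toMeasure_compact_lt_top (hm n) (isCompact_compactCovering X n)
      (disjointed_subset _ n)

theorem toMeasure_addPoint {ω : Configuration X} {x : X} (h : x ∉ ω.points) {A : Set X}
    (hA : MeasurableSet A) : (ω.addPoint x).toMeasure A = ω.toMeasure A + A.indicator 1 x := by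
  have e : (ω.addPoint x).points = insert x ω.points := points_addPoint ω x
  rw [toMeasure_apply _ hA, toMeasure_apply _ hA, e, add_comm]
  rw [Set.insert_eq, ENNReal.summable.tsum_union_disjoint (by simpa using h) ENNReal.summable]
  simp

theorem measurable_iff {α : Type*} [MeasurableSpace α] {f : α → Configuration X}
    (h : ∀ A : Set X, MeasurableSet A → Measurable fun a => (f a).toMeasure A) : Measurable f :=
  measurable_comap_iff.2 (Measure.measurable_of_measurable_coe _ h)

end Measurable

section AddPointsMeasurable

variable {X : Type*} [MetricSpace X] [SigmaCompactSpace X] [MeasurableSpace X] [BorelSpace X]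

/-- A point lies in `ω` exactly when `ω` gives it non-zero mass. That mass is the kernel measure of
a section of the diagonal, which is measurable by second countability. -/
theorem measurableSet_mem_points :
    MeasurableSet {p : Configuration X × X | p.2 ∈ p.1.points} := by
  have : SecondCountableTopology X := EMetric.secondCountable_of_sigmaCompact X
  have ht : MeasurableSet {q : (Configuration X × X) × X | q.2 = q.1.2} :=
    measurableSet_eq_fun measurable_snd (measurable_snd.comp measurable_fst)
  have h := Kernel.measurable_kernel_prodMk_left (κ := Kernel.prodMkRight X (kernel X)) ht
  have e : {p : Configuration X × X | p.2 ∈ p.1.points} =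
      {p | (Kernel.prodMkRight X (kernel X)) p (Prod.mk p ⁻¹'
        {q : (Configuration X × X) × X | q.2 = q.1.2}) ≠ 0} := by
    ext ⟨ω, x⟩
    have e' : (Prod.mk (ω, x) ⁻¹' {q : (Configuration X × X) × X | q.2 = q.1.2}) = {x} := by
      ext y; simp
    simp only [Set.mem_ofPred_eq, e', Kernel.prodMkRight_apply, kernel_apply]
    rw [toMeasure_apply ω (measurableSet_singleton x), ne_eq, ENNReal.tsum_eq_zero]
    simp
  rw [e]
  exact (h (measurableSet_singleton 0)).compl

theorem measurable_addPoint :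
    Measurable fun p : Configuration X × X => p.1.addPoint p.2 := by
  classical
  refine measurable_iff fun A hA => ?_
  have e : (fun p : Configuration X × X => (p.1.addPoint p.2).toMeasure A) = fun p =>
      if p.2 ∈ p.1.points then p.1.toMeasure A else p.1.toMeasure A + A.indicator 1 p.2 := by
    ext p
    split_ifs with h
    · rw [addPoint_of_mem h]
    · rw [toMeasure_addPoint h hA]
  rw [e]
  have h1 : Measurable fun p : Configuration X × X => p.1.toMeasure A :=
    (measurable_toMeasure_apply hA).comp measurable_fst
  exact Measurable.ite measurableSet_mem_points h1
    (h1.add ((measurable_one.indicator hA).comp measurable_snd))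

theorem measurable_addPoints_fin (n : ℕ) :
    Measurable fun p : Configuration X × (Fin n → X) => p.1.addPoints p.2 := by
  induction n with
  | zero => simpa only [addPoints_of_isEmpty] using measurable_fst
  | succ n ih =>
    have e : (fun p : Configuration X × (Fin (n + 1) → X) => p.1.addPoints p.2) =
        fun p => (p.1.addPoint (p.2 0)).addPoints fun i : Fin n => p.2 i.succ := by
      ext1 p
      rw [← addPoints_cons]
      congr 1
      exact (Fin.cons_self_tail p.2).symm
    rw [e]
    refine ih.comp (Measurable.prodMk (measurable_addPoint.comp
      (measurable_fst.prodMk ((measurable_pi_apply 0).comp measurable_snd))) ?_)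
    exact measurable_pi_lambda _ fun i => (measurable_pi_apply _).comp measurable_snd

theorem measurable_addPoints {ι : Type*} [Finite ι] :
    Measurable fun p : Configuration X × (ι → X) => p.1.addPoints p.2 := by
  obtain ⟨n, ⟨e⟩⟩ := Finite.exists_equiv_fin ι
  have h : (fun p : Configuration X × (ι → X) => p.1.addPoints p.2) =
      fun p => p.1.addPoints (p.2 ∘ e.symm) := by
    ext1 p
    rw [addPoints_comp_equiv]
  rw [h]
  have h1 : Measurable fun s : ι → X => s ∘ e.symm :=
    measurable_pi_lambda _ fun i => measurable_pi_apply _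
  exact (measurable_addPoints_fin n).comp (measurable_fst.prodMk (h1.comp measurable_snd))

end AddPointsMeasurable

end Configuration

/-! ### The Stein identity for Poisson counts of compact sets -/

theorem ProbabilityTheory.lintegral_natCast_mul_poissonMeasure (r : NNReal) (h : ℕ → ENNReal) :
    ∫⁻ k, k * h k ∂(poissonMeasure r) = r * ∫⁻ k, h (k + 1) ∂(poissonMeasure r) := by
  simp_rw [poissonMeasure, lintegral_sum_measure, lintegral_smul_measure, lintegral_dirac]
  rw [tsum_eq_zero_add' ENNReal.summable, ← ENNReal.tsum_mul_left]
  simp only [Nat.cast_zero, zero_mul, smul_eq_mul, mul_zero, zero_add]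
  refine tsum_congr fun n => ?_
  have e : ENNReal.ofReal (Real.exp (-r) * r ^ (n + 1) / (n + 1).factorial) *
      ((n + 1 : ℕ) : ENNReal) = r * ENNReal.ofReal (Real.exp (-r) * r ^ n / n.factorial) := by
    rw [← ENNReal.ofReal_natCast, ← ENNReal.ofReal_coe_nnreal, ← ENNReal.ofReal_mul (by positivity),
      ← ENNReal.ofReal_mul (by positivity)]
    congr 1
    rw [Nat.factorial_succ]
    push_cast
    field_simp
    ring
  rw [← mul_assoc, e, mul_assoc]

theorem IsPoissonLaw.lintegral_count_mul {X : Type*} [TopologicalSpace X] [MeasurableSpace X]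
    {σ : Measure X} [IsFiniteMeasureOnCompacts σ] {π : Measure (Configuration X)} (hπ : IsPoissonLaw σ π)
    {A : Set X} (hA : IsCompact A) {h : ENNReal → ENNReal} (hh : Measurable h) :
    ∫⁻ t, t * h t ∂(π.map fun ω => ω.toMeasure A) =
      σ A * ∫⁻ t, h (t + 1) ∂(π.map fun ω => ω.toMeasure A) := by
  have hc : Measurable fun k : ℕ => (k : ENNReal) := measurable_from_top
  rw [hπ.poisson_count A hA, lintegral_map (by fun_prop) hc, lintegral_map (by fun_prop) hc,
    lintegral_natCast_mul_poissonMeasure, ENNReal.coe_toNNReal hA.measure_lt_top.ne]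
  simp

namespace IsPoissonLaw

section Compact

variable {X : Type*} [MetricSpace X] [MeasurableSpace X] [BorelSpace X] {σ : Measure X}
  [IsFiniteMeasureOnCompacts σ] {π : Measure (Configuration X)}

theorem lintegral_toMeasure_compact (hπ : IsPoissonLaw σ π) {A : Set X} (hA : IsCompact A) :
    ∫⁻ ω, ω.toMeasure A ∂π = σ A := by
  have hm := Configuration.measurable_toMeasure_apply hA.measurableSet
  have h := hπ.lintegral_count_mul hA (h := fun _ => 1) measurable_const
  have := hπ.isProbabilityMeasure
  have := Measure.isProbabilityMeasure_map (μ := π) hm.aemeasurable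
  rw [lintegral_map (by fun_prop) hm] at h
  simpa using h

/-- The Stein identity for the counts of disjoint compact sets. -/
theorem lintegral_count_mul_of_isCompact (hπ : IsPoissonLaw σ π) {m : ℕ} {B : Fin m → Set X}
    (hB : ∀ i, IsCompact (B i)) (hd : ∀ i j, i ≠ j → Disjoint (B i) (B j)) (j : Fin m)
    {g : (Fin m → ENNReal) → ENNReal} (hg : Measurable g) :
    ∫⁻ ω, ω.toMeasure (B j) * g (fun i => ω.toMeasure (B i)) ∂π =
      σ (B j) * ∫⁻ ω, g (fun i => ω.toMeasure (B i) + if i = j then 1 else 0) ∂π := by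
  have := hπ.isProbabilityMeasure
  have hm : ∀ i, Measurable fun ω : Configuration X => ω.toMeasure (B i) := fun i =>
    Configuration.measurable_toMeasure_apply (hB i).measurableSet
  have hmap := (iIndepFun_iff_map_fun_eq_pi_map fun i => (hm i).aemeasurable).1
    (hπ.indep_count m B hB hd)
  have hprob : ∀ i, IsProbabilityMeasure (π.map fun ω : Configuration X => ω.toMeasure (B i)) :=
    fun i => Measure.isProbabilityMeasure_map (hm i).aemeasurable
  have hN : Measurable fun (ω : Configuration X) (i : Fin m) => ω.toMeasure (B i) :=
    measurable_pi_lambda _ hm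
  have hf : Measurable fun v : Fin m → ENNReal => v j * g v := (measurable_pi_apply j).mul hg
  have l1 : ∫⁻ ω, ω.toMeasure (B j) * g (fun i => ω.toMeasure (B i)) ∂π =
      ∫⁻ v, v j * g v
        ∂(Measure.pi fun i => π.map fun ω : Configuration X => ω.toMeasure (B i)) := by
    rw [← hmap, lintegral_map hf hN]
  have ha : Measurable fun (v : Fin m → ENNReal) (i : Fin m) => v i + if i = j then 1 else 0 :=
    measurable_pi_lambda _ fun i => (measurable_pi_apply i).add_const _
  have hga : Measurable fun v : Fin m → ENNReal => g fun i => v i + if i = j then 1 else 0 :=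
    hg.comp ha
  have l2 : ∫⁻ ω, g (fun i => ω.toMeasure (B i) + if i = j then 1 else 0) ∂π =
      ∫⁻ v, g (fun i => v i + if i = j then 1 else 0)
        ∂(Measure.pi fun i => π.map fun ω : Configuration X => ω.toMeasure (B i)) := by
    rw [← hmap, lintegral_map hga hN]
  rw [l1, l2]
  -- By independence the joint law is a product. Splitting off coordinate `j` and freezing the
  -- others leaves the one-variable Stein identity.
  obtain _ | m := m
  · exact j.elim0
  set μ : Fin (m + 1) → Measure ENNReal := fun i =>
    π.map fun ω : Configuration X => ω.toMeasure (B i)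
  have hp := (measurePreserving_piFinSuccAbove μ j).symm
  rw [← hp.lintegral_comp hf,
    ← hp.lintegral_comp hga]
  have hi : Measurable fun p : ENNReal × (Fin m → ENNReal) =>
    (MeasurableEquiv.piFinSuccAbove (fun _ => ENNReal) j).symm p := MeasurableEquiv.measurable _
  have hf' : Measurable fun p : ENNReal × (Fin m → ENNReal) =>
      (MeasurableEquiv.piFinSuccAbove (fun _ => ENNReal) j).symm p j *
        g ((MeasurableEquiv.piFinSuccAbove (fun _ => ENNReal) j).symm p) := hf.comp hi
  have hga' : Measurable fun p : ENNReal × (Fin m → ENNReal) =>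
      g fun i => (MeasurableEquiv.piFinSuccAbove (fun _ => ENNReal) j).symm p i +
        if i = j then 1 else 0 := hga.comp hi
  rw [lintegral_prod_symm _ hf'.aemeasurable, lintegral_prod_symm _ hga'.aemeasurable,
    ← lintegral_const_mul _ (Measurable.lintegral_prod_left' hga')]
  refine lintegral_congr fun y => ?_
  have hh : Measurable fun t => g (j.insertNth t y) :=
    hg.comp (hi.comp (measurable_id.prodMk measurable_const))
  have h := hπ.lintegral_count_mul (hB j) hh
  have e : ∀ t : ENNReal, (fun i : Fin (m + 1) =>
      (j.insertNth t y : Fin (m + 1) → ENNReal) i + if i = j then 1 else 0) =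
      j.insertNth (t + 1) y := by
    intro t
    ext i
    refine Fin.succAboveCases j ?_ (fun i => ?_) i <;> simp
  simpa [MeasurableEquiv.piFinSuccAbove, Fin.insertNthEquiv, e] using h

end Compact

variable {X : Type*} [MetricSpace X] [SigmaCompactSpace X] [MeasurableSpace X] [BorelSpace X]
  {σ : Measure X} [IsFiniteMeasureOnCompacts σ] {π : Measure (Configuration X)}

/-- Compact sets form a π-system, which generates the Borel sets because a closed set is the
countable union of its intersections with a compact covering. Hence the mean count of every Borel
set is its `σ`-mass. -/
theorem bind_kernel (hπ : IsPoissonLaw σ π) : π.bind (Configuration.kernel X) = σ := by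
  have key : ∀ K : Set X, IsCompact K → (π.bind (Configuration.kernel X)) K = σ K := by
    intro K hK
    rw [Measure.bind_apply hK.measurableSet (Kernel.aemeasurable _)]
    exact hπ.lintegral_toMeasure_compact hK
  refine Measure.ext_of_generateFrom_of_iUnion {K : Set X | IsCompact K} (compactCovering X) ?_
    (fun s hs t ht _ => hs.inter ht) (iUnion_compactCovering X) (isCompact_compactCovering X)
    (fun n => ?_) key
  · rw [BorelSpace.measurable_eq (α := X), borel_eq_generateFrom_isClosed]
    refine le_antisymm (MeasurableSpace.generateFrom_le fun s hs => ?_)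
      (MeasurableSpace.generateFrom_mono fun s hs => IsCompact.isClosed hs)
    rw [← Set.inter_univ s, ← iUnion_compactCovering X, Set.inter_iUnion]
    exact MeasurableSet.iUnion fun n => MeasurableSpace.measurableSet_generateFrom
      ((isCompact_compactCovering X n).inter_left hs)
  · rw [key _ (isCompact_compactCovering X n)]
    exact (isCompact_compactCovering X n).measure_lt_top.ne

theorem lintegral_toMeasure (hπ : IsPoissonLaw σ π) {A : Set X} (hA : MeasurableSet A) :
    ∫⁻ ω, ω.toMeasure A ∂π = σ A := by
  conv_rhs => rw [← hπ.bind_kernel]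
  rw [Measure.bind_apply hA (Kernel.aemeasurable _)]
  rfl

end IsPoissonLaw

/-- Inner regularity gives compact sets missing less than `1 / (n + 1)` of the mass; their finite
unions are increasing. -/
theorem MeasurableSet.exists_monotone_isCompact_measure_diff_eq_zero {X : Type*} [MetricSpace X]
    [MeasurableSpace X] [BorelSpace X] {σ : Measure X} [σ.InnerRegularCompactLTTop] {A : Set X}
    (hA : MeasurableSet A) (hσ : σ A ≠ ⊤) :
    ∃ C : ℕ → Set X, Monotone C ∧ (∀ n, IsCompact (C n)) ∧ (∀ n, C n ⊆ A) ∧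
      σ (A \ ⋃ n, C n) = 0 := by
  have h : ∀ n : ℕ, ∃ K ⊆ A, IsCompact K ∧ σ (A \ K) < (n + 1 : ENNReal)⁻¹ := fun n =>
    hA.exists_isCompact_sdiff_lt hσ (by simp)
  choose K hKA hK hlt using h
  refine ⟨fun n => ⋃ i ∈ Finset.range (n + 1), K i, ?_, ?_, ?_, ?_⟩
  · intro m n hmn
    exact Set.biUnion_subset_biUnion_left fun i hi => by
      simp only [Finset.mem_range, Finset.mem_coe] at hi ⊢
      lia
  · exact fun n => (Finset.range (n + 1)).isCompact_biUnion fun i _ => hK i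
  · exact fun n => Set.iUnion₂_subset fun i _ => hKA i
  · refine le_antisymm (ENNReal.le_of_forall_pos_le_add fun ε hε _ => ?_) zero_le
    obtain ⟨n, hn⟩ := ENNReal.exists_inv_nat_lt (ENNReal.coe_pos.2 hε).ne'
    have hsub : K n ⊆ ⋃ n, ⋃ i ∈ Finset.range (n + 1), K i := fun x hx => by
      simp only [Set.mem_iUnion]
      exact ⟨n, n, by simp, hx⟩
    rw [zero_add]
    refine (measure_mono (Set.sdiff_subset_sdiff_right hsub)).trans
      ((hlt n).le.trans (le_trans ?_ hn.le))
    exact ENNReal.inv_le_inv.2 le_self_add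

/-! ### From compact to relatively compact sets -/

namespace IsPoissonLaw

variable {X : Type*} [MetricSpace X] [SigmaCompactSpace X] [MeasurableSpace X] [BorelSpace X]
  {σ : Measure X} [IsFiniteMeasureOnCompacts σ] {π : Measure (Configuration X)}

open Filter Topology

/-- Almost surely no point of `ω` falls in the null remainder, and each of the finitely many points
in `B` enters some `C n`. The counts become equal rather than merely converge, so functions of them
pass to the limit without continuity. -/
theorem ae_eventually_toMeasure_eq (hπ : IsPoissonLaw σ π) {B K : Set X} (hB : MeasurableSet B)
    (hK : IsCompact K) (hBK : B ⊆ K) {C : ℕ → Set X} (hCm : Monotone C)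
    (hC : ∀ n, MeasurableSet (C n)) (hCB : ∀ n, C n ⊆ B) (h0 : σ (B \ ⋃ n, C n) = 0) :
    ∀ᵐ ω ∂π, ∀ᶠ n in atTop, ω.toMeasure (C n) = ω.toMeasure B := by
  have hm : MeasurableSet (B \ ⋃ n, C n) := hB.diff (MeasurableSet.iUnion hC)
  have h := hπ.lintegral_toMeasure hm
  rw [h0, lintegral_eq_zero_iff (Configuration.measurable_toMeasure_apply hm)] at h
  filter_upwards [h] with ω hω
  rw [Configuration.toMeasure_apply ω hm, Pi.zero_apply, ENNReal.tsum_eq_zero] at hω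
  have hfin : (ω.points ∩ B).Finite :=
    (ω.finite_inter K hK).subset (Set.inter_subset_inter_right _ hBK)
  have hsub : ∀ x ∈ ω.points ∩ B, ∀ᶠ n in atTop, x ∈ C n := by
    rintro x ⟨hx, hxB⟩
    have h' := hω ⟨x, hx⟩
    have hxC : x ∈ ⋃ n, C n := by
      by_contra hxC
      simp [hxB, hxC] at h'
    obtain ⟨n, hn⟩ := Set.mem_iUnion.1 hxC
    exact (eventually_ge_atTop n).mono fun k hk => hCm hk hn
  filter_upwards [(eventually_all_finite hfin).2 hsub] with n hn
  refine ω.toMeasure_congr (hC n) hB (Set.Subset.antisymm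
    (Set.inter_subset_inter_right _ (hCB n)) ?_)
  exact fun x hx => ⟨hx.1, hn x hx⟩

/-- The Stein identity for the counts of disjoint relatively compact sets. -/
theorem lintegral_count_mul_fin [SigmaFinite σ] (hπ : IsPoissonLaw σ π) {m : ℕ}
    {B : Fin m → Set X} {K : Set X}
    (hB : ∀ i, MeasurableSet (B i)) (hK : IsCompact K) (hBK : ∀ i, B i ⊆ K)
    (hd : ∀ i j, i ≠ j → Disjoint (B i) (B j)) (j : Fin m)
    {g : (Fin m → ENNReal) → ENNReal} (hg : Measurable g) (hg1 : ∀ v, g v ≤ 1) :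
    ∫⁻ ω, ω.toMeasure (B j) * g (fun i => ω.toMeasure (B i)) ∂π =
      σ (B j) * ∫⁻ ω, g (fun i => ω.toMeasure (B i) + if i = j then 1 else 0) ∂π := by
  have := hπ.isProbabilityMeasure
  have hσ : ∀ i, σ (B i) ≠ ⊤ := fun i =>
    ((measure_mono (hBK i)).trans_lt hK.measure_lt_top).ne
  have hex := fun i => (hB i).exists_monotone_isCompact_measure_diff_eq_zero (hσ i)
  choose C hCm hC hCB h0 using hex
  have hCms : ∀ i n, MeasurableSet (C i n) := fun i n => (hC i n).measurableSet
  have hev : ∀ᵐ ω ∂π, ∀ᶠ n in atTop, ∀ i, ω.toMeasure (C i n) = ω.toMeasure (B i) := by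
    filter_upwards [ae_all_iff.2 fun i => hπ.ae_eventually_toMeasure_eq (hB i) hK (hBK i) (hCm i)
      (hCms i) (hCB i) (h0 i)] with ω hω
    exact eventually_all.2 hω
  have hmC : ∀ i n, Measurable fun ω : Configuration X => ω.toMeasure (C i n) := fun i n =>
    Configuration.measurable_toMeasure_apply (hCms i n)
  have heq := fun n => hπ.lintegral_count_mul_of_isCompact (B := fun i => C i n) (fun i => hC i n)
    (fun i k hik => (hd i k hik).mono (hCB i n) (hCB k n)) j hg
  -- As `g ≤ 1`, the integrand is dominated by the count of `B j`, whose mean `σ (B j)` is finite.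
  have t1 : Tendsto (fun n => ∫⁻ ω, ω.toMeasure (C j n) * g (fun i => ω.toMeasure (C i n)) ∂π)
      atTop (𝓝 (∫⁻ ω, ω.toMeasure (B j) * g (fun i => ω.toMeasure (B i)) ∂π)) := by
    refine tendsto_lintegral_of_dominated_convergence (fun ω => ω.toMeasure (B j))
      (fun n => (hmC j n).mul (hg.comp (measurable_pi_lambda _ fun i => hmC i n)))
      (fun n => ae_of_all _ fun ω => ?_) ?_ ?_
    · calc _ ≤ ω.toMeasure (C j n) * 1 := mul_le_mul_right (hg1 _) _
        _ ≤ _ := by rw [mul_one]; exact measure_mono (hCB j n)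
    · rw [hπ.lintegral_toMeasure (hB j)]
      exact hσ j
    · filter_upwards [hev] with ω hω
      refine tendsto_const_nhds.congr' ?_
      filter_upwards [hω] with n hn
      simp_rw [hn]
  have t2 : Tendsto (fun n => ∫⁻ ω, g (fun i => ω.toMeasure (C i n) + if i = j then 1 else 0) ∂π)
      atTop (𝓝 (∫⁻ ω, g (fun i => ω.toMeasure (B i) + if i = j then 1 else 0) ∂π)) := by
    refine tendsto_lintegral_of_dominated_convergence (fun _ => 1)
      (fun n => hg.comp (measurable_pi_lambda _ fun i => (hmC i n).add_const _))
      (fun n => ae_of_all _ fun ω => hg1 _) (by simp) ?_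
    filter_upwards [hev] with ω hω
    refine tendsto_const_nhds.congr' ?_
    filter_upwards [hω] with n hn
    simp_rw [hn]
  have t3 : Tendsto (fun n => σ (C j n)) atTop (𝓝 (σ (B j))) := by
    have h := tendsto_measure_iUnion_atTop (μ := σ) (hCm j)
    have e : σ (⋃ n, C j n) = σ (B j) := by
      refine le_antisymm (measure_mono (Set.iUnion_subset (hCB j))) ?_
      calc σ (B j) ≤ σ ((⋃ n, C j n) ∪ (B j \ ⋃ n, C j n)) := measure_mono fun x hx => by
            by_cases h : x ∈ ⋃ n, C j n
            · exact Or.inl h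
            · exact Or.inr ⟨hx, h⟩
        _ ≤ _ := (measure_union_le _ _).trans (by rw [h0 j, add_zero])
    exact e ▸ h
  have hfin : ∫⁻ ω, g (fun i => ω.toMeasure (B i) + if i = j then 1 else 0) ∂π ≠ ⊤ := by
    refine ne_top_of_le_ne_top (b := 1) (by simp) ((lintegral_mono fun ω => hg1 _).trans ?_)
    simp
  exact tendsto_nhds_unique t1
    ((ENNReal.Tendsto.mul t3 (Or.inr hfin) t2 (Or.inr (hσ j))).congr fun n => (heq n).symm)

theorem lintegral_count_mul_fintype [SigmaFinite σ] (hπ : IsPoissonLaw σ π) {ι : Type*}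
    [Fintype ι] [DecidableEq ι] {B : ι → Set X} {K : Set X}
    (hB : ∀ i, MeasurableSet (B i)) (hK : IsCompact K) (hBK : ∀ i, B i ⊆ K)
    (hd : Pairwise (Function.onFun Disjoint B)) (j : ι)
    {g : (ι → ENNReal) → ENNReal} (hg : Measurable g) (hg1 : ∀ v, g v ≤ 1) :
    ∫⁻ ω, ω.toMeasure (B j) * g (fun i => ω.toMeasure (B i)) ∂π =
      σ (B j) * ∫⁻ ω, g (fun i => ω.toMeasure (B i) + if i = j then 1 else 0) ∂π := by
  let e := Fintype.equivFin ι
  have hm : Measurable fun (v : Fin (Fintype.card ι) → ENNReal) (i : ι) => v (e i) :=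
    measurable_pi_lambda _ fun i => measurable_pi_apply _
  have h := hπ.lintegral_count_mul_fin (B := fun i => B (e.symm i)) (fun i => hB _) hK
    (fun i => hBK _) (fun i k hik => hd (e.symm.injective.ne hik)) (e j) (hg.comp hm)
    (fun v => hg1 _)
  simpa using h

end IsPoissonLaw

/-! ### Cylinder events -/

namespace Configuration

section Cylinders

variable {X : Type*} [TopologicalSpace X] [MeasurableSpace X]

theorem ae_notMem_points (σ : Measure X) [NullSingletonClass σ] (ω : Configuration X) :
    ∀ᵐ x ∂σ, x ∉ ω.points :=
  measure_eq_zero_iff_ae_notMem.1 (ω.countable_points.measure_zero σ)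

/-- The measurable subsets of compact sets. -/
def relativelyCompactSets (X : Type*) [TopologicalSpace X] [MeasurableSpace X] : Set (Set X) :=
  {A | MeasurableSet A ∧ ∃ K, IsCompact K ∧ A ⊆ K}

theorem isPiSystem_relativelyCompactSets : IsPiSystem (relativelyCompactSets X) := by
  rintro A ⟨hA, K, hK, hAK⟩ B ⟨hB, -⟩ -
  exact ⟨hA.inter hB, K, hK, Set.inter_subset_left.trans hAK⟩

/-- The events that depend on the counts of finitely many relatively compact sets. -/
def cylinders (X : Type*) [TopologicalSpace X] [MeasurableSpace X] :
    Set (Set (Configuration X)) :=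
  piiUnionInter (fun A : Set X => {s | MeasurableSet[MeasurableSpace.comap
    (fun ω : Configuration X => ω.toMeasure A) inferInstance] s}) (relativelyCompactSets X)

theorem isPiSystem_cylinders : IsPiSystem (cylinders X) :=
  isPiSystem_piiUnionInter _ (fun A => @MeasurableSpace.isPiSystem_measurableSet _
    (MeasurableSpace.comap (fun ω : Configuration X => ω.toMeasure A) inferInstance)) _

theorem univ_mem_cylinders : Set.univ ∈ cylinders X :=
  ⟨∅, by simp, fun _ => ∅, by simp, by simp⟩

end Cylinders

variable {X : Type*} [MetricSpace X] [SigmaCompactSpace X] [MeasurableSpace X] [BorelSpace X]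

theorem compactCovering_mem (n : ℕ) : compactCovering X n ∈ relativelyCompactSets X :=
  ⟨(isCompact_compactCovering X n).measurableSet, _, isCompact_compactCovering X n, subset_rfl⟩

theorem inter_compactCovering_mem {A : Set X} (hA : MeasurableSet A) (n : ℕ) :
    A ∩ compactCovering X n ∈ relativelyCompactSets X :=
  ⟨hA.inter (isCompact_compactCovering X n).measurableSet, _, isCompact_compactCovering X n,
    Set.inter_subset_right⟩

theorem generateFrom_relativelyCompactSets :
    MeasurableSpace.generateFrom (relativelyCompactSets X) = ‹MeasurableSpace X› := by
  refine le_antisymm (MeasurableSpace.generateFrom_le fun A hA => hA.1) fun A hA => ?_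
  rw [← Set.inter_univ A, ← iUnion_compactCovering X, Set.inter_iUnion]
  exact MeasurableSet.iUnion fun n => MeasurableSpace.measurableSet_generateFrom
    (inter_compactCovering_mem hA n)

/-- Counts of relatively compact sets suffice: the count of any `A` is the supremum of those of its
intersections with an increasing compact covering. -/
theorem generateFrom_cylinders :
    MeasurableSpace.generateFrom (cylinders X) = instMeasurableSpace := by
  refine (generateFrom_piiUnionInter_measurableSet (fun A : Set X => MeasurableSpace.comap
    (fun ω : Configuration X => ω.toMeasure A) inferInstance) _).trans ?_
  refine le_antisymm (iSup₂_le fun A hA => ?_) ?_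
  · exact (measurable_toMeasure_apply hA.1).comap_le
  · refine Measurable.comap_le (@Measure.measurable_of_measurable_coe X (Configuration X) _
      (⨆ A ∈ relativelyCompactSets X, MeasurableSpace.comap
        (fun ω : Configuration X => ω.toMeasure A) inferInstance) toMeasure fun A hA => ?_)
    have e : (fun ω : Configuration X => ω.toMeasure A) =
        fun ω => ⨆ n, ω.toMeasure (A ∩ compactCovering X n) := by
      ext ω
      rw [← Monotone.measure_iUnion, ← Set.inter_iUnion, iUnion_compactCovering, Set.inter_univ]
      exact fun m n hmn => Set.inter_subset_inter_right _ (compactCovering_subset X hmn)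
    rw [e]
    refine Measurable.iSup fun n => ?_
    exact Measurable.mono (comap_measurable fun ω : Configuration X =>
      ω.toMeasure (A ∩ compactCovering X n))
      (le_iSup₂_of_le _ (inter_compactCovering_mem hA n) le_rfl) le_rfl

end Configuration

/-! ### The one-point Mecke formula -/

namespace IsPoissonLaw

open Configuration

variable {X : Type*} [MetricSpace X] [SigmaCompactSpace X] [MeasurableSpace X] [BorelSpace X]
  {σ : Measure X} [SigmaFinite σ] [IsFiniteMeasureOnCompacts σ] [NullSingletonClass σ]
  {π : Measure (Configuration X)}

theorem measurable_addPoint_prodMk :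
    Measurable fun p : Configuration X × X => (p.1.addPoint p.2, p.2) :=
  measurable_addPoint.prodMk measurable_snd

/-- These are the two sides of the Stein identity with `g` the indicator of `S`: for almost every
`x` in `B j`, adding `x` raises the `j`-th count by one and, by disjointness, no other. -/
theorem compProd_kernel_prod_of_pairwise_disjoint (hπ : IsPoissonLaw σ π) {ι : Type*} [Fintype ι]
    {B : ι → Set X} {K : Set X} (hB : ∀ i, MeasurableSet (B i)) (hK : IsCompact K)
    (hBK : ∀ i, B i ⊆ K) (hd : Pairwise (Function.onFun Disjoint B)) (j : ι)
    {S : Set (ι → ENNReal)} (hS : MeasurableSet S) :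
    (π ⊗ₘ kernel X) ({ω | (fun i => ω.toMeasure (B i)) ∈ S} ×ˢ B j) =
      (π.prod σ).map (fun p => (p.1.addPoint p.2, p.2))
        ({ω | (fun i => ω.toMeasure (B i)) ∈ S} ×ˢ B j) := by
  classical
  have := hπ.isProbabilityMeasure
  have hN : Measurable fun (ω : Configuration X) (i : ι) => ω.toMeasure (B i) :=
    measurable_pi_lambda _ fun i => measurable_toMeasure_apply (hB i)
  have hH : MeasurableSet {ω : Configuration X | (fun i => ω.toMeasure (B i)) ∈ S} := hN hS
  have key := hπ.lintegral_count_mul_fintype hB hK hBK hd j (g := S.indicator 1)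
    (measurable_one.indicator hS) (fun v => Set.indicator_le_self' (fun _ _ => zero_le) v)
  rw [Measure.compProd_apply_prod hH (hB j),
    Measure.map_apply measurable_addPoint_prodMk (hH.prod (hB j)),
    Measure.prod_apply (measurable_addPoint_prodMk (hH.prod (hB j)))]
  calc ∫⁻ ω in {ω | (fun i => ω.toMeasure (B i)) ∈ S}, kernel X ω (B j) ∂π
      = ∫⁻ ω, ω.toMeasure (B j) * S.indicator 1 (fun i => ω.toMeasure (B i)) ∂π := by
        rw [← lintegral_indicator hH]
        refine lintegral_congr fun ω => ?_
        by_cases h : (fun i => ω.toMeasure (B i)) ∈ S <;> simp [h]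
    _ = ∫⁻ ω, σ (B j) *
          S.indicator 1 (fun i => ω.toMeasure (B i) + if i = j then 1 else 0) ∂π := by
        rw [key, lintegral_const_mul]
        exact (measurable_one.indicator hS).comp
          (measurable_pi_lambda _ fun i => (measurable_toMeasure_apply (hB i)).add_const _)
    _ = _ := by
        refine lintegral_congr fun ω => ?_
        have hae : ((fun p : Configuration X × X => (p.1.addPoint p.2, p.2)) ∘ Prod.mk ω) ⁻¹'
              ({ω | (fun i => ω.toMeasure (B i)) ∈ S} ×ˢ B j) =ᵐ[σ]
            {x | x ∈ B j ∧ (fun i => ω.toMeasure (B i) + if i = j then 1 else 0) ∈ S} := by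
          filter_upwards [ae_notMem_points σ ω] with x hx
          refine propext ?_
          by_cases hxj : x ∈ B j
          · have e : (fun i => (ω.addPoint x).toMeasure (B i)) =
                fun i => ω.toMeasure (B i) + if i = j then 1 else 0 := by
              ext i
              rw [toMeasure_addPoint hx (hB i)]
              congr 1
              split_ifs with hij
              · subst hij; simp [hxj]
              · exact Set.indicator_of_notMem
                  (fun hxi => Set.disjoint_left.1 (hd hij) hxi hxj) _
            change ((fun i => (ω.addPoint x).toMeasure (B i)) ∈ S ∧ x ∈ B j) ↔ (x ∈ B j ∧ _ ∈ S)
            rw [e, and_comm]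
          · exact ⟨fun h => absurd h.2 hxj, fun h => absurd h.1 hxj⟩
        rw [← Set.preimage_comp, measure_congr hae]
        by_cases h : (fun i => ω.toMeasure (B i) + if i = j then 1 else 0) ∈ S <;> simp [h]

/-- The sets defining `H` may overlap each other and `C`. Passing to the atoms they generate reduces
to the disjoint case, since counts add over atoms and `C` is a union of atoms. -/
theorem compProd_kernel_prod_of_mem_cylinders (hπ : IsPoissonLaw σ π) {H : Set (Configuration X)}
    (hH : H ∈ cylinders X) {C : Set X} (hC : C ∈ relativelyCompactSets X) :
    (π ⊗ₘ kernel X) (H ×ˢ C) = (π.prod σ).map (fun p => (p.1.addPoint p.2, p.2)) (H ×ˢ C) := by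
  classical
  obtain ⟨T, hT, f, hf, rfl⟩ := hH
  let T' : Finset (Set X) := insert C T
  have hT' : ∀ A ∈ T', A ∈ relativelyCompactSets X := by
    intro A hA
    rcases Finset.mem_insert.1 hA with rfl | hA
    exacts [hC, hT hA]
  choose! L hL hAL using fun A hA => (hT' A hA).2
  let K : Set X := ⋃ A ∈ T', L A
  have hK : IsCompact K := T'.isCompact_biUnion hL
  have hTK : ∀ A ∈ T', A ⊆ K := fun A hA =>
    (hAL A hA).trans (Set.subset_biUnion_of_mem (u := L) (Finset.mem_coe.2 hA))
  -- Atoms are indexed by membership patterns; intersecting with `K` keeps the atom outside all the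
  -- sets relatively compact.
  let B : (T' → Prop) → Set X := fun b => K ∩ ⋂ A : T', {x | x ∈ (A : Set X) ↔ b A}
  have hB : ∀ b, MeasurableSet (B b) := by
    refine fun b => hK.measurableSet.inter (MeasurableSet.iInter fun A => ?_)
    by_cases hb : b A
    · simpa [hb] using (hT' A A.2).1
    · have e : {x | x ∈ (A : Set X) ↔ b A} = (A : Set X)ᶜ := by ext x; simp [hb]
      exact e ▸ (hT' A A.2).1.compl
  have hd : Pairwise (Function.onFun Disjoint B) := by
    refine fun b c hbc => Set.disjoint_left.2 fun x hx hx' => hbc (funext fun A => propext ?_)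
    exact (Set.mem_iInter.1 hx.2 A).symm.trans (Set.mem_iInter.1 hx'.2 A)
  have hU : ∀ A : T', (A : Set X) = ⋃ b ∈ Finset.univ.filter (fun b : T' → Prop => b A), B b := by
    intro A
    ext x
    simp only [Finset.mem_filter, Finset.mem_univ, true_and, Set.mem_iUnion, exists_prop]
    constructor
    · exact fun hx => ⟨fun A' => x ∈ (A' : Set X), hx, hTK A A.2 hx,
        Set.mem_iInter.2 fun A' => Iff.rfl⟩
    · rintro ⟨b, hb, -, hx⟩
      exact (Set.mem_iInter.1 hx A).2 hb
  have hsum : ∀ (A : T') (ω : Configuration X), ω.toMeasure (A : Set X) =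
      ∑ b ∈ Finset.univ.filter (fun b : T' → Prop => b A), ω.toMeasure (B b) := by
    intro A ω
    conv_lhs => rw [hU A]
    exact measure_biUnion_finset (fun b _ c _ hbc => hd hbc) fun b _ => hB b
  choose! s hs hsf using hf
  -- `C` itself need not belong to `T`, in which case it imposes no condition on the counts.
  let S : Set ((T' → Prop) → ENNReal) := ⋂ A : T', if (A : Set X) ∈ T then
    (fun v => ∑ b ∈ Finset.univ.filter (fun b : T' → Prop => b A), v b) ⁻¹' s A else Set.univ
  have hS : MeasurableSet S := by
    refine MeasurableSet.iInter fun A => ?_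
    split_ifs with h
    · exact (Finset.measurable_sum _ fun b _ => measurable_pi_apply b) (hs A h)
    · exact MeasurableSet.univ
  have hH : (⋂ A ∈ T, f A) = {ω : Configuration X | (fun b => ω.toMeasure (B b)) ∈ S} := by
    ext ω
    simp only [S, Set.mem_iInter, Set.mem_ofPred_eq]
    constructor
    · intro h A
      split_ifs with hA
      · have := h A hA
        rw [← hsf A hA] at this
        simpa [← hsum A ω] using this
      · trivial
    · intro h A hA
      have := h ⟨A, Finset.mem_insert_of_mem hA⟩
      rw [if_pos hA] at this
      rw [← hsf A hA]
      simpa [← hsum ⟨A, Finset.mem_insert_of_mem hA⟩ ω] using this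
  have hHm : MeasurableSet (⋂ A ∈ T, f A) := by
    rw [hH]
    exact (measurable_pi_lambda _ fun b => measurable_toMeasure_apply (hB b)) hS
  have hprod : (⋂ A ∈ T, f A) ×ˢ C = ⋃ b ∈ Finset.univ.filter
      (fun b : T' → Prop => b ⟨C, Finset.mem_insert_self C T⟩), (⋂ A ∈ T, f A) ×ˢ B b := by
    conv_lhs => rw [show C = _ from hU ⟨C, Finset.mem_insert_self C T⟩]
    simp only [Set.prod_iUnion]
  rw [hprod, measure_biUnion_finset, measure_biUnion_finset]
  · rw [hH]
    exact Finset.sum_congr rfl fun b _ =>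
      hπ.compProd_kernel_prod_of_pairwise_disjoint hB hK (fun b => Set.inter_subset_left) hd b hS
  · exact fun b _ c _ hbc => Set.disjoint_prod.2 (Or.inr (hd hbc))
  · exact fun b _ => hHm.prod (hB b)
  · exact fun b _ c _ hbc => Set.disjoint_prod.2 (Or.inr (hd hbc))
  · exact fun b _ => hHm.prod (hB b)

/-- The Mecke formula, as an equality of measures. -/
theorem compProd_kernel (hπ : IsPoissonLaw σ π) :
    π ⊗ₘ kernel X = (π.prod σ).map (fun p => (p.1.addPoint p.2, p.2)) := by
  have := hπ.isProbabilityMeasure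
  refine Measure.ext_of_generateFrom_of_iUnion
    (Set.image2 (· ×ˢ ·) (cylinders X) (relativelyCompactSets X))
    (fun n => Set.univ ×ˢ compactCovering X n)
    (generateFrom_eq_prod generateFrom_cylinders generateFrom_relativelyCompactSets
      ⟨fun _ => Set.univ, fun _ => univ_mem_cylinders, Set.iUnion_const _⟩
      ⟨compactCovering X, compactCovering_mem, iUnion_compactCovering X⟩).symm
    (isPiSystem_cylinders.prod isPiSystem_relativelyCompactSets) ?_
    (fun n => ⟨_, univ_mem_cylinders, _, compactCovering_mem n, rfl⟩) (fun n => ?_) ?_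
  · rw [← Set.prod_iUnion, iUnion_compactCovering, Set.univ_prod_univ]
  · have hc := isCompact_compactCovering X n
    rw [Measure.compProd_apply_prod MeasurableSet.univ hc.measurableSet, Measure.restrict_univ]
    exact (hπ.lintegral_toMeasure hc.measurableSet).trans_lt hc.measure_lt_top |>.ne
  · rintro _ ⟨H, hH, C, hC, rfl⟩
    exact hπ.compProd_kernel_prod_of_mem_cylinders hH hC

/-- The Mecke formula. -/
theorem lintegral_lintegral_toMeasure (hπ : IsPoissonLaw σ π)
    {f : Configuration X → X → ENNReal} (hf : Measurable (Function.uncurry f)) :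
    ∫⁻ ω, ∫⁻ x, f ω x ∂ω.toMeasure ∂π = ∫⁻ ω, ∫⁻ x, f (ω.addPoint x) x ∂σ ∂π := by
  have := hπ.isProbabilityMeasure
  have h := Measure.lintegral_compProd (μ := π) (κ := kernel X) hf
  have hf' : Measurable fun p : Configuration X × X => Function.uncurry f (p.1.addPoint p.2, p.2) :=
    hf.comp measurable_addPoint_prodMk
  rw [hπ.compProd_kernel, lintegral_map hf measurable_addPoint_prodMk,
    lintegral_prod _ hf'.aemeasurable] at h
  exact h.symm

end IsPoissonLaw

/-! ### Sums over distinct points and the multivariate Mecke formula -/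

namespace Configuration

section FactorialSum

variable {X : Type*} [TopologicalSpace X]

/-- The sum of `f` over the families of pairwise distinct points of `ω`, indexed by `ι`. -/
noncomputable def factorialSum {ι : Type*} (ω : Configuration X) (f : (ι → X) → ENNReal) :
    ENNReal :=
  ∑' s : ι ↪ ω.points, f fun i => s i

theorem factorialSum_comp_equiv {ι κ : Type*} (e : κ ≃ ι) (ω : Configuration X)
    (f : (κ → X) → ENNReal) : ω.factorialSum (fun s : ι → X => f (s ∘ e)) = ω.factorialSum f := by
  exact Equiv.tsum_eq (Equiv.embeddingCongr e.symm (Equiv.refl _))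
    fun s : κ ↪ ω.points => f fun i => s i

theorem factorialSum_of_isEmpty {ι : Type*} [IsEmpty ι] (ω : Configuration X)
    (f : (ι → X) → ENNReal) (s : ι → X) : ω.factorialSum f = f s := by
  rw [factorialSum, tsum_eq_single ⟨isEmptyElim, fun a => isEmptyElim a⟩]
  · congr 1
    exact Subsingleton.elim _ _
  · exact fun b hb => absurd (Subsingleton.elim _ _) hb

/-- Distinct `k + 1` points are distinct `k` points and one more outside their range; the indicator
discards the repetitions. -/
theorem factorialSum_succ [MeasurableSpace X] {k : ℕ} (ω : Configuration X)
    (f : (Fin (k + 1) → X) → ENNReal)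
    (hf : ∀ s : Fin k → X,
      Measurable ((Set.range s)ᶜ.indicator fun x => f (Fin.cons x s : Fin (k + 1) → X))) :
    ω.factorialSum f = ω.factorialSum fun s : Fin k → X => ∫⁻ x,
      (Set.range s)ᶜ.indicator (fun x => f (Fin.cons x s : Fin (k + 1) → X)) x ∂ω.toMeasure := by
  rw [factorialSum, ← (Equiv.embeddingFinSucc k ω.points).symm.tsum_eq, ENNReal.tsum_sigma']
  refine tsum_congr fun s => ?_
  refine Eq.trans ?_ (lintegral_toMeasure ω (hf fun i => s i)).symm
  have e : ∀ b : ((Set.range s)ᶜ : Set ω.points),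
      (fun i => ((Equiv.embeddingFinSucc k ω.points).symm ⟨s, b⟩ i : X)) =
        (Fin.cons ((b : ω.points) : X) (fun i => (s i : X)) : Fin (k + 1) → X) := by
    intro b
    ext i
    rw [Equiv.coe_embeddingFinSucc_symm]
    refine Fin.cases ?_ (fun i => ?_) i <;> simp
  refine (tsum_congr fun b => congrArg f (e b)).trans ?_
  refine (tsum_subtype ((Set.range s)ᶜ : Set ω.points)
    fun b => f (Fin.cons (b : X) (fun i => (s i : X)) : Fin (k + 1) → X)).trans ?_
  refine tsum_congr fun b => ?_
  have hmem : b ∈ ((Set.range s)ᶜ : Set ω.points) ↔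
      (b : X) ∈ (Set.range fun i => (s i : X))ᶜ := by
    simp only [Set.mem_compl_iff, Set.mem_range, Subtype.ext_iff]
  by_cases hb : b ∈ ((Set.range s)ᶜ : Set ω.points)
  · rw [Set.indicator_of_mem hb, Set.indicator_of_mem (hmem.1 hb)]
  · rw [Set.indicator_of_notMem hb, Set.indicator_of_notMem (fun h => hb (hmem.2 h))]

theorem lintegral_toMeasure_addPoints [MeasurableSpace X] {ι : Type*} [Finite ι]
    (ω : Configuration X) (s : ι → X) {f : X → ENNReal} (hf : Measurable f) (h : ∀ i, f (s i) = 0) :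
    ∫⁻ x, f x ∂(ω.addPoints s).toMeasure = ∫⁻ x, f x ∂ω.toMeasure := by
  rw [lintegral_toMeasure _ hf, lintegral_toMeasure _ hf, tsum_subtype, tsum_subtype]
  refine tsum_congr fun x => ?_
  by_cases hx : x ∈ ω.points
  · rw [Set.indicator_of_mem hx,
      Set.indicator_of_mem (show x ∈ (ω.addPoints s).points from Or.inl hx)]
  · rw [Set.indicator_of_notMem hx]
    by_cases hs : x ∈ (ω.addPoints s).points
    · obtain ⟨i, rfl⟩ := hs.resolve_left hx
      rw [Set.indicator_of_mem hs, h i]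
    · rw [Set.indicator_of_notMem hs]

end FactorialSum

end Configuration

namespace IsPoissonLaw

open Configuration

variable {X : Type*} [MetricSpace X] [SigmaCompactSpace X] [MeasurableSpace X] [BorelSpace X]
  {σ : Measure X} [SigmaFinite σ] [IsFiniteMeasureOnCompacts σ] [NullSingletonClass σ]
  {π : Measure (Configuration X)}

theorem measurable_indicator_compl_range {k : ℕ} {f : Configuration X → (Fin (k + 1) → X) → ENNReal}
    (hf : Measurable (Function.uncurry f)) :
    Measurable fun p : (Configuration X × (Fin k → X)) × X =>
      (Set.range p.1.2)ᶜ.indicator (fun x => f p.1.1 (Fin.cons x p.1.2 : Fin (k + 1) → X)) p.2 := by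
  classical
  have : SecondCountableTopology X := EMetric.secondCountable_of_sigmaCompact X
  have hm : MeasurableSet {p : (Configuration X × (Fin k → X)) × X | p.2 ∈ (Set.range p.1.2)ᶜ} := by
    have e : {p : (Configuration X × (Fin k → X)) × X | p.2 ∈ (Set.range p.1.2)ᶜ} =
        (⋃ i, {p : (Configuration X × (Fin k → X)) × X | p.1.2 i = p.2})ᶜ := by
      ext p; simp
    rw [e]
    exact (MeasurableSet.iUnion fun i => measurableSet_eq_fun (by fun_prop) (by fun_prop)).compl
  have hc : Measurable fun p : (Configuration X × (Fin k → X)) × X =>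
      (Fin.cons p.2 p.1.2 : Fin (k + 1) → X) := by
    refine measurable_pi_lambda _ fun i => ?_
    refine Fin.cases ?_ (fun i => ?_) i
    · simpa using measurable_snd
    · simp only [Fin.cons_succ]
      fun_prop
  have h1 : Measurable fun p : (Configuration X × (Fin k → X)) × X =>
      f p.1.1 (Fin.cons p.2 p.1.2 : Fin (k + 1) → X) :=
    hf.comp ((measurable_fst.comp measurable_fst).prodMk hc)
  exact Measurable.ite hm h1 measurable_const

/-- Induction on `k`: the sum over the first point is absorbed into `g`, the hypothesis handles the
other `k`, and for these fixed the one-point formula handles the first. Measurability of the sum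
over distinct points comes from the same recursion. -/
theorem factorialSum_fin (hπ : IsPoissonLaw σ π) {k : ℕ}
    {f : Configuration X → (Fin k → X) → ENNReal}
    (hf : Measurable (Function.uncurry f)) :
    Measurable (fun ω : Configuration X => ω.factorialSum (f ω)) ∧
    ∫⁻ ω, ω.factorialSum (f ω) ∂π =
      ∫⁻ ω, ∫⁻ s, f (ω.addPoints s) s ∂(Measure.pi fun _ => σ) ∂π := by
  have := hπ.isProbabilityMeasure
  induction k with
  | zero =>
    have e : ∀ ω : Configuration X, ω.factorialSum (f ω) = f ω isEmptyElim := fun ω =>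
      factorialSum_of_isEmpty ω _ _
    simp_rw [e]
    refine ⟨hf.comp (measurable_id.prodMk measurable_const), lintegral_congr fun ω => ?_⟩
    have e' : ∀ s, f (ω.addPoints s) s = f ω isEmptyElim := fun s => by
      rw [addPoints_of_isEmpty]
      exact congrArg _ (Subsingleton.elim _ _)
    simp_rw [e']
    simp
  | succ k ih =>
    have hind := measurable_indicator_compl_range hf
    let g : Configuration X → (Fin k → X) → ENNReal := fun ω s => ∫⁻ x,
      (Set.range s)ᶜ.indicator (fun x => f ω (Fin.cons x s : Fin (k + 1) → X)) x ∂ω.toMeasure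
    have hg : Measurable (Function.uncurry g) :=
      Measurable.lintegral_kernel_prod_right (κ := Kernel.prodMkRight (Fin k → X) (kernel X))
        (f := fun p x => (Set.range p.2)ᶜ.indicator
          (fun x => f p.1 (Fin.cons x p.2 : Fin (k + 1) → X)) x) hind
    have hsec : ∀ ω (s : Fin k → X), Measurable
        ((Set.range s)ᶜ.indicator fun x => f ω (Fin.cons x s : Fin (k + 1) → X)) := by
      intro ω s
      have hl : Measurable fun x : X => ((ω, s), x) := measurable_prodMk_left
      have h := hind.comp hl
      simp only [Function.comp_def] at h
      exact h
    have e : ∀ ω : Configuration X, ω.factorialSum (f ω) = ω.factorialSum (g ω) := fun ω =>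
      factorialSum_succ ω (f ω) (hsec ω)
    simp_rw [e]
    refine ⟨(ih hg).1, (ih hg).2.trans ?_⟩
    have hadd := measurable_addPoints (X := X) (ι := Fin k)
    have hadd' := measurable_addPoints (X := X) (ι := Fin (k + 1))
    have hcons : Measurable fun p : X × (Fin k → X) => (Fin.cons p.1 p.2 : Fin (k + 1) → X) := by
      refine measurable_pi_lambda _ fun i => ?_
      refine Fin.cases ?_ (fun i => ?_) i
      · simpa using measurable_fst
      · simp only [Fin.cons_succ]
        fun_prop
    have hgm : Measurable fun p : Configuration X × (Fin k → X) => g (p.1.addPoints p.2) p.2 := by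
      have hpair : Measurable fun p : Configuration X × (Fin k → X) => (p.1.addPoints p.2, p.2) :=
        hadd.prodMk measurable_snd
      have h := hg.comp hpair
      simp only [Function.comp_def, Function.uncurry_apply_pair] at h
      exact h
    have hfm : Measurable fun p : Configuration X × (Fin (k + 1) → X) =>
        f (p.1.addPoints p.2) p.2 :=
      hf.comp (hadd'.prodMk measurable_snd)
    have hfc : Measurable fun p : (Configuration X × (Fin k → X)) × X =>
        f (p.1.1.addPoints (Fin.cons p.2 p.1.2 : Fin (k + 1) → X)) (Fin.cons p.2 p.1.2) :=
      hfm.comp ((measurable_fst.comp measurable_fst).prodMk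
        (hcons.comp (measurable_snd.prodMk (measurable_snd.comp measurable_fst))))
    have step : ∀ s : Fin k → X, ∫⁻ ω, g (ω.addPoints s) s ∂π =
        ∫⁻ ω, ∫⁻ x, f (ω.addPoints (Fin.cons x s : Fin (k + 1) → X)) (Fin.cons x s) ∂σ ∂π := by
      intro s
      -- The indicator kills the added points, so integration is against `ω` itself, as the
      -- one-point formula requires.
      have h1 : ∀ ω : Configuration X, g (ω.addPoints s) s = ∫⁻ x, (Set.range s)ᶜ.indicator
          (fun x => f (ω.addPoints s) (Fin.cons x s : Fin (k + 1) → X)) x ∂ω.toMeasure := fun ω =>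
        lintegral_toMeasure_addPoints ω s (hsec _ s) fun i => by simp
      simp_rw [h1]
      have hm : Measurable fun p : Configuration X × X => (Set.range s)ᶜ.indicator
          (fun x => f (p.1.addPoints s) (Fin.cons x s : Fin (k + 1) → X)) p.2 :=
        hind.comp (((hadd.comp (measurable_fst.prodMk measurable_const)).prodMk
          measurable_const).prodMk measurable_snd)
      rw [hπ.lintegral_lintegral_toMeasure (f := fun ω x => (Set.range s)ᶜ.indicator
          (fun x => f (ω.addPoints s) (Fin.cons x s : Fin (k + 1) → X)) x) hm]
      refine lintegral_congr fun ω => lintegral_congr_ae ?_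
      -- Under the diffuse measure `σ` the exclusion of the finitely many points `s` has no effect.
      have h0 : σ (Set.range s) = 0 := (Set.finite_range s).measure_zero σ
      filter_upwards [measure_eq_zero_iff_ae_notMem.1 h0] with x hx
      rw [Set.indicator_of_mem (show x ∈ (Set.range s)ᶜ from hx), addPoints_cons]
    rw [lintegral_lintegral_swap hgm.aemeasurable]
    simp_rw [step]
    rw [lintegral_lintegral_swap]
    · refine lintegral_congr fun ω => ?_
      have hp := (measurePreserving_piFinSuccAbove (fun _ : Fin (k + 1) => σ) 0).symm
      have hω : Measurable fun s : Fin (k + 1) → X => f (ω.addPoints s) s :=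
        hfm.comp measurable_prodMk_left
      have hω' : Measurable fun p : X × (Fin k → X) =>
          f (ω.addPoints (Fin.cons p.1 p.2 : Fin (k + 1) → X)) (Fin.cons p.1 p.2) :=
        hω.comp hcons
      rw [← hp.lintegral_comp hω]
      have e2 : ∀ p : X × (Fin k → X),
          (MeasurableEquiv.piFinSuccAbove (fun _ : Fin (k + 1) => X) 0).symm p =
            Fin.cons p.1 p.2 := fun p => by
        simp [MeasurableEquiv.piFinSuccAbove, Fin.insertNthEquiv]
      simp_rw [e2]
      exact (lintegral_prod_symm _ hω'.aemeasurable).symm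
    · exact (Measurable.lintegral_prod_right' (f := fun p : ((Fin k → X) × Configuration X) × X =>
        f (p.1.2.addPoints (Fin.cons p.2 p.1.1 : Fin (k + 1) → X)) (Fin.cons p.2 p.1.1))
        (hfc.comp ((measurable_swap.comp measurable_fst).prodMk measurable_snd))).aemeasurable

end IsPoissonLaw

/-! ### Arbitrary finite index types and real-valued integrands -/

namespace IsPoissonLaw

open Configuration

variable {X : Type*} [MetricSpace X] [SigmaCompactSpace X] [MeasurableSpace X] [BorelSpace X]
  {σ : Measure X} [SigmaFinite σ] [IsFiniteMeasureOnCompacts σ] [NullSingletonClass σ]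
  {π : Measure (Configuration X)} {ι : Type*} [Fintype ι]

theorem factorialSum_fintype (hπ : IsPoissonLaw σ π)
    {f : Configuration X → (ι → X) → ENNReal} (hf : Measurable (Function.uncurry f)) :
    Measurable (fun ω : Configuration X => ω.factorialSum (f ω)) ∧
    ∫⁻ ω, ω.factorialSum (f ω) ∂π =
      ∫⁻ ω, ∫⁻ s, f (ω.addPoints s) s ∂(Measure.pi fun _ => σ) ∂π := by
  let e := Fintype.equivFin ι
  have hc : Measurable fun s : Fin (Fintype.card ι) → X => s ∘ e :=
    measurable_pi_lambda _ fun i => measurable_pi_apply _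
  have hf' : Measurable (Function.uncurry fun (ω : Configuration X)
      (s : Fin (Fintype.card ι) → X) => f ω (s ∘ e)) :=
    hf.comp (measurable_fst.prodMk (hc.comp measurable_snd))
  have h := hπ.factorialSum_fin hf'
  simp_rw [factorialSum_comp_equiv e] at h
  refine ⟨h.1, h.2.trans (lintegral_congr fun ω => ?_)⟩
  have hp := measurePreserving_piCongrLeft (fun _ : ι => σ) e.symm
  have hω : Measurable fun s : ι → X => f (ω.addPoints s) s :=
    hf.comp ((measurable_addPoints.comp measurable_prodMk_left).prodMk measurable_id)
  rw [← hp.lintegral_comp hω]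
  refine lintegral_congr fun s => ?_
  have e1 : (MeasurableEquiv.piCongrLeft (fun _ : ι => X) e.symm) s = s ∘ e := by
    ext i
    obtain ⟨k, rfl⟩ := e.symm.surjective i
    rw [MeasurableEquiv.coe_piCongrLeft, Equiv.piCongrLeft_apply_apply]
    simp
  rw [e1, addPoints_comp_equiv]

/-- The multivariate Mecke formula for bounded functions with compact support. -/
theorem integral_tsum_embedding (hπ : IsPoissonLaw σ π) {f : Configuration X → (ι → X) → ℝ}
    (hf : Measurable (Function.uncurry f)) {C : ℝ} (hfC : ∀ ω s, |f ω s| ≤ C) {K : Set X}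
    (hK : IsCompact K) (hfK : ∀ ω s i, s i ∉ K → f ω s = 0) :
    Integrable (fun p : Configuration X × (ι → X) => f (p.1.addPoints p.2) p.2)
      (π.prod (Measure.pi fun _ => σ)) ∧
    Integrable (fun ω : Configuration X => ∑' s : ι ↪ ω.points, f ω fun i => s i) π ∧
    ∫ ω, ∑' s : ι ↪ ω.points, f ω (fun i => s i) ∂π =
      ∫ ω, ∫ s, f (ω.addPoints s) s ∂(Measure.pi fun _ => σ) ∂π := by
  have := hπ.isProbabilityMeasure
  have hfm : Measurable fun p : Configuration X × (ι → X) => f (p.1.addPoints p.2) p.2 :=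
    hf.comp (measurable_addPoints.prodMk measurable_snd)
  have hint : Integrable (fun p : Configuration X × (ι → X) => f (p.1.addPoints p.2) p.2)
      (π.prod (Measure.pi fun _ => σ)) := by
    have hKm : MeasurableSet ((Set.univ : Set (Configuration X)) ×ˢ Set.univ.pi fun _ : ι => K) :=
      MeasurableSet.univ.prod (MeasurableSet.univ_pi fun _ => hK.measurableSet)
    have hI : Integrable (((Set.univ : Set (Configuration X)) ×ˢ
        Set.univ.pi fun _ : ι => K).indicator fun _ => C) (π.prod (Measure.pi fun _ => σ)) := by
      refine (integrable_indicator_iff hKm).2 (integrableOn_const ?_)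
      rw [Measure.prod_prod, Measure.pi_pi, measure_univ, one_mul]
      exact (ENNReal.prod_lt_top fun i _ => hK.measure_lt_top).ne
    refine hI.mono' hfm.aestronglyMeasurable (ae_of_all _ fun p => ?_)
    by_cases hp : ∀ i, p.2 i ∈ K
    · rw [Set.indicator_of_mem (by simpa using hp)]
      exact hfC _ _
    · push Not at hp
      obtain ⟨i, hi⟩ := hp
      rw [hfK _ _ i hi, norm_zero]
      exact Set.indicator_nonneg (fun _ _ => (abs_nonneg _).trans (hfC p.1 p.2)) _
  refine ⟨hint, ?_⟩
  have hpos : Measurable (Function.uncurry fun ω s => ENNReal.ofReal (f ω s)) := hf.ennreal_ofReal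
  have hneg : Measurable (Function.uncurry fun ω s => ENNReal.ofReal (-f ω s)) :=
    hf.neg.ennreal_ofReal
  obtain ⟨mp, ep⟩ := hπ.factorialSum_fintype hpos
  obtain ⟨mn, en⟩ := hπ.factorialSum_fintype hneg
  rw [← lintegral_prod (fun p : Configuration X × (ι → X) =>
    ENNReal.ofReal (f (p.1.addPoints p.2) p.2)) hfm.ennreal_ofReal.aemeasurable] at ep
  rw [← lintegral_prod (fun p : Configuration X × (ι → X) =>
    ENNReal.ofReal (-f (p.1.addPoints p.2) p.2)) hfm.neg.ennreal_ofReal.aemeasurable] at en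
  have tp : ∫⁻ ω : Configuration X, ω.factorialSum (fun s => ENNReal.ofReal (f ω s)) ∂π ≠ ⊤ :=
    ep ▸ hint.lintegral_lt_top.ne
  have tn : ∫⁻ ω : Configuration X, ω.factorialSum (fun s => ENNReal.ofReal (-f ω s)) ∂π ≠ ⊤ :=
    en ▸ hint.neg.lintegral_lt_top.ne
  have fp := ae_lt_top mp tp
  have fn := ae_lt_top mn tn
  -- Almost surely both the positive and the negative sums are finite, so the real sum converges
  -- absolutely and splits.
  have hae : (fun ω : Configuration X => ∑' s : ι ↪ ω.points, f ω fun i => s i) =ᵐ[π]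
      fun ω => (ω.factorialSum fun s => ENNReal.ofReal (f ω s)).toReal -
        (ω.factorialSum fun s => ENNReal.ofReal (-f ω s)).toReal := by
    filter_upwards [fp, fn] with ω hp hn
    rw [factorialSum, factorialSum, ENNReal.tsum_toReal_eq fun _ => ENNReal.ofReal_ne_top,
      ENNReal.tsum_toReal_eq fun _ => ENNReal.ofReal_ne_top,
      ← (ENNReal.summable_toReal hp.ne).tsum_sub (ENNReal.summable_toReal hn.ne)]
    refine tsum_congr fun s => ?_
    rw [ENNReal.toReal_ofReal', ENNReal.toReal_ofReal']
    exact (max_zero_sub_max_neg_zero_eq_self _).symm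
  have ip := integrable_toReal_of_lintegral_ne_top mp.aemeasurable tp
  have in' := integrable_toReal_of_lintegral_ne_top mn.aemeasurable tn
  refine ⟨(ip.sub in').congr hae.symm, ?_⟩
  rw [integral_congr_ae hae, integral_sub ip in', integral_toReal mp.aemeasurable fp,
    integral_toReal mn.aemeasurable fn, ep, en,
    ← integral_prod (fun p : Configuration X × (ι → X) => f (p.1.addPoints p.2) p.2) hint]
  exact (integral_eq_lintegral_pos_part_sub_lintegral_neg_part hint).symm

end IsPoissonLaw

/-! ### Expanding a power over set partitions -/

namespace Finpartition

variable {ι α : Type*} [Fintype ι] [DecidableEq ι]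

/-- The block of a point, as an element of the set of blocks. -/
def block (P : Finpartition (Finset.univ : Finset ι)) (i : ι) : P.parts :=
  ⟨P.part i, P.part_mem.2 (Finset.mem_univ i)⟩

theorem block_eq_iff (P : Finpartition (Finset.univ : Finset ι)) {i : ι} {p : P.parts} :
    P.block i = p ↔ i ∈ (p : Finset ι) := by
  rw [Subtype.ext_iff]
  constructor
  · rintro h
    rw [← h]
    exact P.mem_part (Finset.mem_univ i)
  · exact fun h => P.part_eq_of_mem p.2 h

/-- Families indexed by a finite type correspond to the pairs of a partition of the index type
and a family of distinct elements indexed by the blocks. -/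
theorem bijective_embedding_comp_block : Function.Bijective
    fun q : (P : Finpartition (Finset.univ : Finset ι)) × (P.parts ↪ α) =>
      fun i => q.2 (q.1.block i) := by
  classical
  constructor
  · rintro ⟨P, s⟩ ⟨Q, t⟩ h
    have h' : ∀ i, s (P.block i) = t (Q.block i) := congrFun h
    -- As `s` and `t` are injective, indices share a block exactly when the family takes equal
    -- values there; hence it determines the partition.
    have hb : ∀ i j, P.block i = P.block j ↔ Q.block i = Q.block j := fun i j => by
      rw [← s.injective.eq_iff, h', h', t.injective.eq_iff]
    have hpart : ∀ i, P.part i = Q.part i := by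
      intro i
      ext j
      have hp := P.block_eq_iff (i := j) (p := P.block i)
      have hq := Q.block_eq_iff (i := j) (p := Q.block i)
      exact hp.symm.trans ((hb j i).trans hq)
    have hPQ : P = Q := by
      ext p
      constructor
      · intro hp
        obtain ⟨i, hi⟩ := P.nonempty_of_mem_parts hp
        rw [← P.part_eq_of_mem hp hi, hpart]
        exact (Q.block i).2
      · intro hp
        obtain ⟨i, hi⟩ := Q.nonempty_of_mem_parts hp
        rw [← Q.part_eq_of_mem hp hi, ← hpart]
        exact (P.block i).2
    subst hPQ
    congr 1
    ext p
    obtain ⟨i, hi⟩ := P.nonempty_of_mem_parts p.2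
    rw [← P.block_eq_iff.2 hi]
    exact h' i
  · intro g
    let P : Finpartition (Finset.univ : Finset ι) := Finpartition.ofSetoid (Setoid.ker g)
    have hP : ∀ i j, P.block i = P.block j ↔ g i = g j := by
      intro i j
      rw [P.block_eq_iff]
      exact (Finpartition.mem_part_ofSetoid_iff_rel (s := Setoid.ker g)).trans eq_comm
    have hne : ∀ p : P.parts, ∃ i, P.block i = p := fun p =>
      (P.nonempty_of_mem_parts p.2).imp fun i hi => P.block_eq_iff.2 hi
    choose r hr using hne
    refine ⟨⟨P, ⟨fun p => g (r p), fun p q hpq => ?_⟩⟩, ?_⟩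
    · rw [← hr p, ← hr q]
      exact (hP _ _).2 hpq
    · ext i
      exact (hP _ _).1 (hr _)

theorem prod_block {M : Type*} [CommMonoid M] (P : Finpartition (Finset.univ : Finset ι))
    (v : P.parts → M) : ∏ i, v (P.block i) = ∏ p : P.parts, v p ^ (p : Finset ι).card := by
  rw [← Finset.prod_fiberwise Finset.univ P.block]
  refine Finset.prod_congr rfl fun p _ => ?_
  rw [Finset.prod_congr rfl (g := fun _ => v p), Finset.prod_const]
  · congr 2
    ext i
    simp [P.block_eq_iff]
  · intro i hi
    rw [(Finset.mem_filter.1 hi).2]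

end Finpartition

/-- Finite support reduces everything to finite sums. The power expands over all maps from `Fin n`
to the support, which are then sorted by their fibre partitions. -/
theorem tsum_pow_eq_sum_finpartition {α R : Type*} [CommSemiring R] [TopologicalSpace R]
    {v : α → R} (hv : (Function.support v).Finite) (n : ℕ) :
    (∑' x, v x) ^ n = ∑ P : Finpartition (Finset.univ : Finset (Fin n)),
      ∑' s : P.parts ↪ α, ∏ p, v (s p) ^ (p : Finset (Fin n)).card := by
  classical
  have : Fintype (Function.support v) := hv.fintype
  have h1 : ∑' x, v x = ∑ x : Function.support v, v x := by
    rw [← tsum_subtype_eq_of_support_subset (s := Function.support v) subset_rfl, tsum_fintype]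
  have h2 : ∀ P : Finpartition (Finset.univ : Finset (Fin n)),
      ∑' s : P.parts ↪ α, ∏ p, v (s p) ^ (p : Finset (Fin n)).card =
        ∑ s : P.parts ↪ Function.support v, ∏ p, v (s p) ^ (p : Finset (Fin n)).card := by
    intro P
    have hinj : Function.Injective fun s : P.parts ↪ Function.support v =>
        s.trans (Function.Embedding.subtype _) := fun s t hst => by
      ext p
      exact DFunLike.congr_fun hst p
    rw [← hinj.tsum_eq (f := fun s : P.parts ↪ α => ∏ p, v (s p) ^ (p : Finset (Fin n)).card),
      tsum_fintype]
    · rfl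
    · intro s hs
      -- Blocks are non-empty, so all exponents are positive and a point outside the support
      -- annihilates the product.
      have hmem : ∀ p, s p ∈ Function.support v := by
        intro p hp
        refine hs (Finset.prod_eq_zero (Finset.mem_univ p) ?_)
        rw [hp, zero_pow (Finset.card_pos.2 (P.nonempty_of_mem_parts p.2)).ne']
      exact ⟨⟨fun p => ⟨s p, hmem p⟩, fun p q hpq => s.injective (Subtype.ext_iff.1 hpq)⟩, rfl⟩
  simp_rw [h1, h2]
  rw [Fintype.sum_pow, ← Finpartition.bijective_embedding_comp_block.sum_comp, Fintype.sum_sigma]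
  exact Finset.sum_congr rfl fun P _ => Finset.sum_congr rfl fun s _ =>
    P.prod_block fun p => v (s p)

/-! ### Integrals against a configuration and the moment identity -/

namespace Configuration

variable {X : Type*} [MetricSpace X] [MeasurableSpace X] [BorelSpace X]

theorem integrable_toMeasure (ω : Configuration X) {v : X → ℝ} (hv : Measurable v) {C : ℝ}
    (hC : ∀ x, |v x| ≤ C) {K : Set X} (hK : IsCompact K) (hvK : ∀ x ∉ K, v x = 0) :
    Integrable v ω.toMeasure := by
  have hs : Function.support v ⊆ K := fun x hx => by
    by_contra h
    exact hx (hvK x h)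
  rw [← integrableOn_iff_integrable_of_support_subset hs]
  exact Measure.integrableOn_of_bounded
    (ω.toMeasure_compact_lt_top hK.measurableSet hK subset_rfl).ne hv.aestronglyMeasurable
    (ae_of_all _ hC)

theorem integral_toMeasure (ω : Configuration X) {v : X → ℝ} (hv : Integrable v ω.toMeasure) :
    ∫ x, v x ∂ω.toMeasure = ∑' x : ω.points, v x := by
  rw [toMeasure, integral_sum_measure hv]
  exact tsum_congr fun x => integral_dirac _ _

end Configuration

theorem proposition3p1 {X : Type*} [MetricSpace X] [SigmaCompactSpace X]
    [MeasurableSpace X] [BorelSpace X]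
    (σ : Measure X) [SigmaFinite σ] [IsFiniteMeasureOnCompacts σ] [NullSingletonClass σ]
    (π : Measure (Configuration X)) (hπ : IsPoissonLaw σ π)
    (F : Configuration X → ℝ) (hF : Measurable F) (hFb : ∃ C : ℝ, ∀ ω, |F ω| ≤ C)
    (u : Configuration X → X → ℝ) (hu : Measurable (Function.uncurry u))
    (hub : ∃ C : ℝ, ∀ ω x, |u ω x| ≤ C)
    (hus : ∃ K : Set X, IsCompact K ∧ ∀ ω, ∀ x ∉ K, u ω x = 0)
    (n : ℕ) :
    (∀ ω : Configuration X, Integrable (u ω) ω.toMeasure) ∧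
    Integrable (fun ω => F ω * (∫ x, u ω x ∂ω.toMeasure) ^ n) π ∧
    (∀ P : Finpartition (Finset.univ : Finset (Fin n)),
      Integrable (Function.uncurry (addedIntegrand F u P))
        (π.prod (Measure.pi fun _ : P.parts => σ))) ∧
    ∫ ω, F ω * (∫ x, u ω x ∂ω.toMeasure) ^ n ∂π =
      ∑ P : Finpartition (Finset.univ : Finset (Fin n)),
        ∫ ω, ∫ s : P.parts → X, addedIntegrand F u P ω s ∂(Measure.pi fun _ => σ) ∂π := by
  obtain ⟨CF, hCF⟩ := hFb
  obtain ⟨Cu, hCu⟩ := hub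
  obtain ⟨K, hK, huK⟩ := hus
  have hui : ∀ ω : Configuration X, Integrable (u ω) ω.toMeasure := fun ω =>
    ω.integrable_toMeasure (hu.comp measurable_prodMk_left) (hCu ω) hK (huK ω)
  -- Here `F` and `u` are evaluated at `ω` itself; replacing `ω` by `ω.addPoints s`, as the Mecke
  -- formula does, gives `addedIntegrand`.
  let f : (P : Finpartition (Finset.univ : Finset (Fin n))) → Configuration X → (P.parts → X) → ℝ :=
    fun P ω s => F ω * ∏ p, u ω (s p) ^ (p : Finset (Fin n)).card
  have hf : ∀ P, Measurable (Function.uncurry (f P)) := fun P =>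
    (hF.comp measurable_fst).mul (Finset.measurable_prod _ fun p _ => (hu.comp
      (measurable_fst.prodMk ((measurable_pi_apply p).comp measurable_snd))).pow_const _)
  have hfC : ∀ P ω s, |f P ω s| ≤ CF * ∏ p : P.parts, Cu ^ (p : Finset (Fin n)).card := by
    intro P ω s
    rw [abs_mul, Finset.abs_prod]
    refine mul_le_mul (hCF ω) (Finset.prod_le_prod (fun p _ => abs_nonneg _) fun p _ => ?_)
      (Finset.prod_nonneg fun p _ => abs_nonneg _) ((abs_nonneg _).trans (hCF ω))
    rw [abs_pow]
    exact pow_le_pow_left₀ (abs_nonneg _) (hCu ω (s p)) _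
  have hfK : ∀ P ω s p, s p ∉ K → f P ω s = 0 := by
    intro P ω s p hp
    refine mul_eq_zero_of_right _ (Finset.prod_eq_zero (Finset.mem_univ p) ?_)
    rw [huK ω _ hp, zero_pow (Finset.card_pos.2 (P.nonempty_of_mem_parts p.2)).ne']
  have hmecke := fun P => hπ.integral_tsum_embedding (hf P) (hfC P) hK (hfK P)
  have hpow : ∀ ω : Configuration X, F ω * (∫ x, u ω x ∂ω.toMeasure) ^ n =
      ∑ P : Finpartition (Finset.univ : Finset (Fin n)),
        ∑' s : P.parts ↪ ω.points, f P ω fun p => s p := by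
    intro ω
    have hfin : (Function.support fun x : ω.points => u ω x).Finite := by
      refine Set.Finite.of_finite_image ((ω.finite_inter K hK).subset ?_)
        Subtype.val_injective.injOn
      rintro _ ⟨x, hx, rfl⟩
      exact ⟨x.2, by_contra fun h => hx (huK ω x h)⟩
    rw [ω.integral_toMeasure (hui ω), tsum_pow_eq_sum_finpartition hfin, Finset.mul_sum]
    exact Finset.sum_congr rfl fun P _ => tsum_mul_left.symm
  simp_rw [hpow]
  refine ⟨hui, integrable_finsetSum _ fun P _ => (hmecke P).2.1, fun P => (hmecke P).1, ?_⟩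
  rw [integral_finsetSum _ fun P _ => (hmecke P).2.1]
  exact Finset.sum_congr rfl fun P _ => (hmecke P).2.2
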